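/- Let $K$ be a finite set, let $\Delta\subset\mathbb R^K$ be the simplex of probability distributions on $K$, and write $\langle s,a\rangle=\sum_{k\in K}s_ka_k$. Let $D$ be a compact space, $g:D\times K\to\mathbb R$ continuous, and let the action set $A\subset\mathbb R^K$ be the closed convex hull of $\{(g(d,k))_{k\in K}: d\in D\}$. Assume that $A$ has more than one point. For $p\in\Delta$ let $A^\star(p)=\{a\in A:\langle p,a'\rangle\le\langle p,a\rangle\ \forall a'\in A\}$ be the set of optimal actions and $v_A(p)=\max_{a\in A}\langle p,a\rangle$ the value function. For $a\in A$ let $N_A(a)=\{s\in\mathbb R^K:\langle s,a'\rangle\le\langle s,a\rangle\ \forall a'\in A\}$ be the normal cone; $a$ is regular if $N_A(a)$ is a half-line $\mathbb R_+ s$ with $s\ne 0$, and then $n_A(a)$ denotes the unit vector spanning it. If $a$ is regular and $n_A$ is differentiable at $a$ along $\partial A$, the Weingarten map is the differential $T_an_A$ on the tangent space $T_a\partial A$, and its eigenvalues are the principal curvatures of $A$ at $a$. $A$ has positive curvature at $a$ if $a$ is regular, $n_A$ is differentiable at $a$, and all principal curvatures of $A$ at $a$ are positive (equivalently, when $\partial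 A$ is a $C^2$ hypersurface, $T_an_A$ has full rank). Suppose that the boundary $\partial A$ is a $C^2$ submanifold of $\mathbb R^K$ of dimension $|K|-1$, and let $\bar p\in\Delta$ be a prior belief with full support ($\bar p_k>0$ for all $k$). Then the following three conditions are equivalent. 1. The set-valued map $A^\star:\Delta\rightrightarrows\partial A$ is a local diffeomorphism at $\bar p$: there is a relatively open neighbourhood of $\bar p$ in $\Delta$ on which $A^\star$ is single-valued, and on which it is a $C^1$ diffeomorphism onto a relatively open subset of $\partial A$. 2. $A^\star(\bar p)$ is a singleton $\{a^\sharp\}$ and $A$ has positive curvature at $a^\sharp$. 3. The value function $v_A:\Delta\to\mathbb R$ is twice differentiable at $\bar p$ (differentiable on a neighbourhood of $\bar p$ in $\Delta$, with derivative differentiable at $\bar p$), and its Hessian at $\bar p$ is positive definite on the tangent space $\{u\in\mathbb R^K:\sum_{k}u_k=0\}$ of $\Delta$. -/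

import Mathlib

namespace FlexibleAgent

section Geometry

/-- `M` is a `C²` submanifold of codimension one: near each of its points it is the zero set of a
`C²` function whose derivative does not vanish at that point. -/
def IsC2Hypersurface {E : Type*} [NormedAddCommGroup E] [NormedSpace ℝ E] (M : Set E) : Prop :=
  ∀ x ∈ M, ∃ (U : Set E) (ρ : E → ℝ), IsOpen U ∧ x ∈ U ∧ ContDiffOn ℝ 2 ρ U ∧
    fderiv ℝ ρ x ≠ 0 ∧ M ∩ U = {y ∈ U | ρ y = 0}

/-- The tangent space at `a` of a subset `M` (used for hypersurfaces `M`), as a linear subspace of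
the ambient space. -/
def tangentSpaceAt {E : Type*} [NormedAddCommGroup E] [NormedSpace ℝ E] (M : Set E) (a : E) :
    Submodule ℝ E :=
  Submodule.span ℝ (tangentConeAt ℝ M a)

/-- The set-valued map `F : S ⇉ T` is a local (`C¹`) diffeomorphism at `p ∈ S`: on some relatively
open neighbourhood `S ∩ U` of `p` it is single-valued, and there it is a bijection onto a relatively
open subset `T ∩ V` of `T`, such that the bijection and its inverse are `C¹`, that is, extend to
`C¹` maps on the open subsets `U` and `V` of the ambient space. -/
def IsLocalDiffeoAt {E : Type*} [NormedAddCommGroup E] [NormedSpace ℝ E]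
    (F : E → Set E) (S T : Set E) (p : E) : Prop :=
  ∃ (U V : Set E) (f g : E → E), IsOpen U ∧ p ∈ U ∧ IsOpen V ∧
    ContDiffOn ℝ 1 f U ∧ ContDiffOn ℝ 1 g V ∧
    (∀ q ∈ S ∩ U, F q = {f q}) ∧
    Set.MapsTo f (S ∩ U) (T ∩ V) ∧ Set.MapsTo g (T ∩ V) (S ∩ U) ∧
    Set.InvOn g f (S ∩ U) (T ∩ V)

/-- The normal cone of `A` at a point `a ∈ A`. -/
def normalCone {E : Type*} [NormedAddCommGroup E] [InnerProductSpace ℝ E] (A : Set E) (a : E) :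
    Set E :=
  {s | ∀ a' ∈ A, inner ℝ s a' ≤ inner ℝ s a}

/-- The closed half-line spanned by `s`. -/
def halfLine {E : Type*} [NormedAddCommGroup E] [InnerProductSpace ℝ E] (s : E) : Set E :=
  {t | ∃ r : ℝ, 0 ≤ r ∧ t = r • s}

/-- `a` is a regular point of `A`: its normal cone is a half-line. -/
def IsRegularPoint {E : Type*} [NormedAddCommGroup E] [InnerProductSpace ℝ E]
    (A : Set E) (a : E) : Prop :=
  a ∈ A ∧ ∃ s : E, s ≠ 0 ∧ normalCone A a = halfLine s

open Classical in
/-- The spherical image map (Gauss map) of `A`: at a regular point, the unique unit outer normal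
vector, i.e. the unit vector that spans the normal cone. (The value `0` at other points is a
convention.) -/
noncomputable def gaussMap {E : Type*} [NormedAddCommGroup E] [InnerProductSpace ℝ E]
    (A : Set E) (a : E) : E :=
  if h : ∃ s : E, ‖s‖ = 1 ∧ normalCone A a = halfLine s then h.choose else 0

/-- The Weingarten map of `A` at `a`: the differential at `a` of the Gauss map along the boundary,
defined on the tangent space of the boundary. (All derivatives of the Gauss map within the boundary
have the same restriction to that space, so `fderivWithin` makes no choice here.) -/
noncomputable def weingartenMap {E : Type*} [NormedAddCommGroup E] [InnerProductSpace ℝ E]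
    (A : Set E) (a : E) : tangentSpaceAt (frontier A) a →ₗ[ℝ] E :=
  (fderivWithin ℝ (gaussMap A) (frontier A) a).toLinearMap.domRestrict
    (tangentSpaceAt (frontier A) a)

/-- `κ` is a principal curvature of `A` at `a`: an eigenvalue of the Weingarten map. -/
def IsPrincipalCurvature {E : Type*} [NormedAddCommGroup E] [InnerProductSpace ℝ E]
    (A : Set E) (a : E) (κ : ℝ) : Prop :=
  ∃ t : tangentSpaceAt (frontier A) a, t ≠ 0 ∧ weingartenMap A a t = κ • (t : E)

/-- `A` has positive curvature at `a`: the point is regular, the Gauss map is differentiable there,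
and all principal curvatures are positive. -/
def HasPositiveCurvatureAt {E : Type*} [NormedAddCommGroup E] [InnerProductSpace ℝ E]
    (A : Set E) (a : E) : Prop :=
  IsRegularPoint A a ∧ DifferentiableWithinAt ℝ (gaussMap A) (frontier A) a ∧
    ∀ κ : ℝ, IsPrincipalCurvature A a κ → 0 < κ

end Geometry

section Decision

/-- The set `Δ(K)` of beliefs: the simplex of `ℝ^K`. -/
def beliefs (K : Type*) [Fintype K] : Set (EuclideanSpace ℝ K) :=
  {p | (∀ k, 0 ≤ p k) ∧ ∑ k, p k = 1}

/-- The direction of the affine span of `Δ(K)`: vectors whose coordinates sum to zero. -/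
def beliefDirections (K : Type*) [Fintype K] : Submodule ℝ (EuclideanSpace ℝ K) where
  carrier := {u | ∑ k, u k = 0}
  zero_mem' := by simp
  add_mem' := by
    intro a b ha hb
    simp only [Set.mem_ofPred_eq] at ha hb
    simp [Finset.sum_add_distrib, ha, hb]
  smul_mem' := by
    intro c a ha
    simp only [Set.mem_ofPred_eq] at ha
    simp [← Finset.mul_sum, ha]

/-- The action set of the decision problem with payoff function `g`: the closed convex hull of the
payoff vectors `(g d k)_k`. -/
def actionSet {K D : Type*} [Fintype K] (g : D → K → ℝ) : Set (EuclideanSpace ℝ K) :=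
  closure (convexHull ℝ (Set.range fun d => WithLp.toLp 2 (g d)))

/-- The optimal actions under belief `p`. -/
def optimalActions {K : Type*} [Fintype K] (A : Set (EuclideanSpace ℝ K))
    (p : EuclideanSpace ℝ K) : Set (EuclideanSpace ℝ K) :=
  {a ∈ A | ∀ a' ∈ A, inner ℝ p a' ≤ inner ℝ p a}

/-- The value function `v_A(p) = max_{a ∈ A} ⟨p, a⟩` (considered for beliefs `p`). -/
noncomputable def valueFunction {K : Type*} [Fintype K] (A : Set (EuclideanSpace ℝ K))
    (p : EuclideanSpace ℝ K) : ℝ :=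
  sSup ((fun a => inner ℝ p a) '' A)

/-- A function on beliefs, read around the full-support belief `p` in the affine chart
`u ↦ p + u` of the simplex, where `u` runs through the vectors of coordinate sum zero. -/
def inBeliefChart {K : Type*} [Fintype K] (v : EuclideanSpace ℝ K → ℝ)
    (p : EuclideanSpace ℝ K) : beliefDirections K → ℝ :=
  fun u => v (p + u)

/-- `v` is, as a function on the simplex, twice differentiable at the full-support belief `p` with
positive definite Hessian: it is differentiable near `p`, its derivative is differentiable at `p`,
and the second derivative is positive definite on the tangent space of the simplex. -/
def TwiceDiffWithPosDefHessianAt {K : Type*} [Fintype K] (v : EuclideanSpace ℝ K → ℝ)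
    (p : EuclideanSpace ℝ K) : Prop :=
  (∀ᶠ u in nhds 0, DifferentiableAt ℝ (inBeliefChart v p) u) ∧
    DifferentiableAt ℝ (fderiv ℝ (inBeliefChart v p)) 0 ∧
    ∀ u : beliefDirections K, u ≠ 0 →
      0 < fderiv ℝ (fderiv ℝ (inBeliefChart v p)) 0 u u

end Decision

end FlexibleAgent

/-!
Let `A` be the action set, `e` the vector of ones, and `H` the space of vectors of coordinate sum
zero. Near `p` the simplex is the hyperplane `⟪e, ·⟫ = 1`, and `A` has interior points because its
boundary is a hypersurface and it is not a single point (`interior_nonempty_of_isC2Hypersurface`).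

At an optimal point `a` of `p`, the Gauss map is best rescaled to the vector field `m` with `⟪e,
m⟫ = 1` (`IsNormalField`), the gradient of a defining function `ρ` of the boundary up to a
positive factor. It is `C¹` in the ambient space, and a boundary point `y` near `a` is optimal for
a belief `q` precisely if `m y = q`: on the boundary, `m` inverts the set-valued map `A⋆`. As the
Weingarten map is monotone and has the same kernel as the differential of `m` on the tangent space
`p^⊥`, positive curvature at `a` means that this differential is injective on `p^⊥`
(`IsNormalField.hasPositiveCurvatureAt_iff`).

* If it is injective, the inverse function theorem applied to `(1 + ρ) m` inverts `m` on the
  boundary (`IsNormalField.isLocalDiffeoAt`).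
* If `A⋆` is near `p` a diffeomorphism `f`, then `f` is the gradient of the value function, so
  that the Hessian is the differential of `f` on `H`. It is symmetric and, by monotonicity of the
  gradient, positive semidefinite. A vector in its kernel is mapped by `f'` into `H^⊥`, but also
  into `p^⊥`, since `⟪p, f⟫` is maximal at `p`; so `f'` vanishes there, which contradicts that `f`
  has a differentiable inverse (`IsLocalDiffeoAt.hessian_posDef`).
* If the value function is twice differentiable at `p`, optimal points near `p` are unique and
  depend differentiably on the belief at `p` (`exists_differentiableAt_optimal`). Differentiating
  `m (f q) = q` shows that `f'` maps `H` isomorphically onto `p^⊥` with inverse `m'`, so `m'` is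
  injective on `p^⊥` (`IsNormalField.injective_of_selection`). The positivity of the Hessian is
  then automatic.
-/

namespace FlexibleAgent

open Filter Topology Set

/-! ### Tangent spaces and normal cones along a hypersurface -/

section Tangent

variable {E : Type*} [NormedAddCommGroup E] [NormedSpace ℝ E]

lemma fderiv_eq_zero_of_mem_tangentConeAt {M U : Set E} {ρ : E → ℝ} {ρ' : E →L[ℝ] ℝ} {a : E}
    (hU : U ∈ 𝓝 a) (hρ : HasFDerivAt ρ ρ' a) (ha : ρ a = 0) (hM : ∀ y ∈ M ∩ U, ρ y = 0) {t : E}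
    (ht : t ∈ tangentConeAt ℝ M a) : ρ' t = 0 := by
  rw [← tangentConeAt_inter_nhds hU] at ht
  have h0 : HasFDerivWithinAt ρ (0 : E →L[ℝ] ℝ) (M ∩ U) a :=
    (hasFDerivWithinAt_const (0 : ℝ) a (M ∩ U)).congr hM ha
  simpa using hρ.hasFDerivWithinAt.unique_on h0 ht

/-- By the implicit function theorem, every vector in the kernel of the derivative of a submersion
is the velocity of a curve in its zero set. -/
lemma mem_tangentConeAt_of_fderiv_eq_zero [CompleteSpace E] {M U : Set E} {ρ : E → ℝ}
    {ρ' : E →L[ℝ] ℝ} {a : E} (hU : U ∈ 𝓝 a) (hρ : HasStrictFDerivAt ρ ρ' a) (hne : ρ' ≠ 0)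
    (ha : ρ a = 0) (hM : ∀ y ∈ U, ρ y = 0 → y ∈ M) {t : E} (ht : ρ' t = 0) :
    t ∈ tangentConeAt ℝ M a := by
  have hr : ρ'.range = ⊤ :=
    LinearMap.range_eq_top.2 (LinearMap.surjective (f := (ρ' : E →ₗ[ℝ] ℝ)) fun h => hne (by
      ext x; simpa using LinearMap.congr_fun h x))
  let k : ρ'.ker := ⟨t, ht⟩
  let γ : ℝ → E := fun s => hρ.implicitFunction ρ ρ' hr (ρ a) (s • k)
  have hγ0 : γ 0 = a := by simp [γ]
  have hlin : HasDerivAt (fun s : ℝ => s • k) k 0 := by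
    simpa using (hasDerivAt_id (0 : ℝ)).smul_const k
  have hγ' : HasDerivAt γ t 0 := by
    have h1 := (hρ.to_implicitFunction hr).hasFDerivAt
    have h2 : HasFDerivAt (hρ.implicitFunction ρ ρ' hr (ρ a)) ρ'.ker.subtypeL ((0 : ℝ) • k) := by
      simpa using h1
    have h3 := h2.comp_hasDerivAt (0 : ℝ) hlin
    exact h3
  have hzero : ∀ᶠ s in 𝓝 (0 : ℝ), ρ (γ s) = 0 := by
    have hc : Tendsto (fun s : ℝ => (ρ a, s • k)) (𝓝 0) (𝓝 (ρ a, 0)) :=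
      tendsto_const_nhds.prodMk_nhds (by simpa using hlin.continuousAt.tendsto)
    filter_upwards [hc.eventually (hρ.map_implicitFunction_eq hr)] with s hs
    exact hs.trans ha
  have hγc : Tendsto γ (𝓝 0) (𝓝 a) := by simpa [hγ0] using hγ'.continuousAt.tendsto
  refine mem_tangentConeAt_of_seq (𝓝[≠] (0 : ℝ)) (fun s => s⁻¹) (fun s => γ s - a) ?_ ?_ ?_
  · simpa using (hγc.mono_left nhdsWithin_le_nhds).sub_const a
  · filter_upwards [(hzero.and (hγc.eventually_mem hU)).filter_mono nhdsWithin_le_nhds] with s hs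
    simpa using hM _ hs.2 hs.1
  · have := hasDerivAt_iff_tendsto_slope.1 hγ'
    refine this.congr fun s => ?_
    simp [slope, hγ0]

/-- The tangent space of the zero set of a submersion is the kernel of the derivative; it is
already exhausted by the tangent cone. -/
lemma tangent_of_zero_set [CompleteSpace E] {M U : Set E} {ρ : E → ℝ}
    {ρ' : E →L[ℝ] ℝ} {a : E} (hU : U ∈ 𝓝 a) (hρ : HasStrictFDerivAt ρ ρ' a) (hne : ρ' ≠ 0)
    (ha : ρ a = 0) (hM : ∀ y ∈ U, y ∈ M ↔ ρ y = 0) (t : E) :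
    (t ∈ tangentSpaceAt M a ↔ ρ' t = 0) ∧ (t ∈ tangentConeAt ℝ M a ↔ ρ' t = 0) := by
  have h1 : ∀ t ∈ tangentConeAt ℝ M a, ρ' t = 0 := fun t ht =>
    fderiv_eq_zero_of_mem_tangentConeAt hU hρ.hasFDerivAt ha (fun y hy => (hM y hy.2).1 hy.1) ht
  have h2 : ρ' t = 0 → t ∈ tangentConeAt ℝ M a := fun ht =>
    mem_tangentConeAt_of_fderiv_eq_zero hU hρ hne ha (fun y hy => (hM y hy).2) ht
  have h3 : tangentSpaceAt M a ≤ LinearMap.ker (ρ' : E →ₗ[ℝ] ℝ) :=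
    Submodule.span_le.2 fun t ht => h1 t ht
  exact ⟨⟨fun h => h3 h, fun h => Submodule.subset_span (h2 h)⟩, h1 t, h2⟩

end Tangent

section Normal

variable {E : Type*} [NormedAddCommGroup E] [InnerProductSpace ℝ E]

/-- If `M ⊆ A` is near `a` the zero set of a submersion, every normal of `A` at `a` is a multiple of
its gradient: the normal restricted to `M` has a constrained maximum at `a`. -/
lemma exists_smul_of_mem_normalCone [CompleteSpace E] {A M U : Set E} {ρ : E → ℝ} {N a s : E}
    (hU : U ∈ 𝓝 a) (hρ : HasStrictFDerivAt ρ (innerSL ℝ N) a) (hne : N ≠ 0)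
    (ha : ρ a = 0) (hM : ∀ y ∈ U, y ∈ M ↔ ρ y = 0) (hMA : M ⊆ A) (hs : s ∈ normalCone A a) :
    ∃ c : ℝ, s = c • N := by
  have hext : IsLocalExtrOn (fun y => innerSL ℝ s y) {y | ρ y = ρ a} a := by
    refine Or.inr ?_
    filter_upwards [self_mem_nhdsWithin, mem_nhdsWithin_of_mem_nhds hU] with y hy hyU
    exact hs y (hMA ((hM y hyU).2 (hy.trans ha)))
  obtain ⟨α, β, h0, h⟩ := hext.exists_multipliers_of_hasStrictFDerivAt_1d hρ
    (innerSL ℝ s).hasStrictFDerivAt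
  have hv : α • N + β • s = 0 := by
    apply ext_inner_right ℝ
    intro y
    have := DFunLike.congr_fun h y
    simpa [inner_add_left, inner_smul_left] using this
  have hβ : β ≠ 0 := by
    rintro rfl
    simp only [zero_smul, add_zero, smul_eq_zero, hne, or_false] at hv
    exact h0 (by simp [hv])
  refine ⟨-(β⁻¹ * α), ?_⟩
  have : s = β⁻¹ • (β • s) := by rw [smul_smul, inv_mul_cancel₀ hβ, one_smul]
  rw [this, eq_neg_of_add_eq_zero_right hv]
  simp [mul_smul]

/-- A function that defines the hypersurface `M` near `a`, with its gradient as a vector field. -/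
lemma IsC2Hypersurface.exists_gradient [CompleteSpace E] {M : Set E} (hM : IsC2Hypersurface M)
    {a : E} (ha : a ∈ M) : ∃ (U : Set E) (ρ : E → ℝ) (N : E → E), IsOpen U ∧ a ∈ U ∧
      ContDiffOn ℝ 1 N U ∧ (∀ y ∈ U, N y ≠ 0) ∧ ContDiffOn ℝ 1 ρ U ∧
      (∀ y ∈ U, HasStrictFDerivAt ρ (innerSL ℝ (N y)) y) ∧ ∀ y ∈ U, y ∈ M ↔ ρ y = 0 := by
  obtain ⟨U, ρ, hU, haU, hρ, hne, hMU⟩ := hM a ha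
  let N : E → E := fun y => (InnerProductSpace.toDual ℝ E).symm (fderiv ℝ ρ y)
  have hN : ContDiffOn ℝ 1 N U :=
    (InnerProductSpace.toDual ℝ E).symm.contDiff.comp_contDiffOn
      (hρ.fderiv_of_isOpen hU (by norm_num))
  have hNa : N a ≠ 0 := by simpa [N] using hne
  have hV : IsOpen (U ∩ N ⁻¹' {0}ᶜ) :=
    hN.continuousOn.isOpen_inter_preimage hU isOpen_compl_singleton
  refine ⟨U ∩ N ⁻¹' {0}ᶜ, ρ, N, hV, ⟨haU, hNa⟩, hN.mono inter_subset_left, fun y hy => hy.2,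
    (hρ.of_le (by norm_num)).mono inter_subset_left, fun y hy => ?_, fun y hy => ?_⟩
  · have hNy : innerSL ℝ (N y) = fderiv ℝ ρ y :=
      (InnerProductSpace.toDual ℝ E).apply_symm_apply (fderiv ℝ ρ y)
    rw [hNy]
    exact (hρ.contDiffAt (hU.mem_nhds hy.1)).hasStrictFDerivAt (by norm_num)
  · have := Set.ext_iff.1 hMU y
    simpa [hy.1] using this

lemma mem_frontier_of_mem_normalCone {A : Set E} {a s : E} (ha : a ∈ A) (hs0 : s ≠ 0)
    (hs : s ∈ normalCone A a) : a ∈ frontier A := by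
  refine ⟨subset_closure ha, fun hi => hs0 ?_⟩
  have hmax : IsLocalMax (fun y => innerSL ℝ s y) a := by
    filter_upwards [mem_interior_iff_mem_nhds.1 hi] with y hy using hs y hy
  have := hmax.hasFDerivAt_eq_zero (innerSL ℝ s).hasFDerivAt
  exact inner_self_eq_zero.1 (DFunLike.congr_fun this s)

/-- A compact convex set with more than one point whose boundary is a hypersurface has interior
points. Otherwise it is its own boundary and lies in a hyperplane with normal `s`, so that `s` spans
the line of normals at each of its points. But for distinct points `x` and `y` of the set, the
vector `x - y`, which is orthogonal to `s`, is a normal at a point that maximizes it. -/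
lemma interior_nonempty_of_isC2Hypersurface [FiniteDimensional ℝ E] {A : Set E} (hc : IsCompact A)
    (hconv : Convex ℝ A) (hnt : A.Nontrivial) (hM : IsC2Hypersurface (frontier A)) :
    (interior A).Nonempty := by
  by_contra hemp
  have hfr : frontier A = A := by
    rw [frontier, hc.isClosed.closure_eq, not_nonempty_iff_eq_empty.1 hemp, sdiff_empty]
  obtain ⟨x, hx, y, hy, hxy⟩ := hnt
  have hspan : vectorSpan ℝ A ≠ ⊤ := by
    intro h
    refine hemp (hconv.interior_nonempty_iff_affineSpan_eq_top.2 ?_)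
    exact (AffineSubspace.affineSpan_eq_top_iff_vectorSpan_eq_top_of_nonempty ℝ E E ⟨x, hx⟩).2 h
  obtain ⟨s, hs, hs0⟩ := Submodule.exists_mem_ne_zero_of_ne_bot
    (fun h => hspan ((Submodule.orthogonal_eq_bot_iff).1 h))
  have hsA : ∀ z ∈ A, ∀ w ∈ A, inner ℝ s (z - w) = (0 : ℝ) := fun z hz w hw =>
    Submodule.inner_left_of_mem_orthogonal (vsub_mem_vectorSpan ℝ hz hw) hs
  obtain ⟨b, hb, hbmax⟩ := hc.exists_isMaxOn ⟨x, hx⟩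
    (innerSL ℝ (x - y)).continuous.continuousOn
  obtain ⟨U, ρ, N, hU, hbU, -, hN0, -, hρ, hMU⟩ := hM.exists_gradient (hfr.symm ▸ hb)
  have hρb := (hMU b hbU).1 (hfr.symm ▸ hb)
  obtain ⟨c, hc1⟩ := exists_smul_of_mem_normalCone (s := x - y) (hU.mem_nhds hbU) (hρ b hbU)
    (hN0 b hbU) hρb hMU hfr.subset (fun z hz => hbmax hz)
  obtain ⟨d, hd1⟩ := exists_smul_of_mem_normalCone (s := s) (hU.mem_nhds hbU) (hρ b hbU)
    (hN0 b hbU) hρb hMU hfr.subset (fun z hz => by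
      have := hsA z hz b hb
      rw [inner_sub_right] at this
      linarith)
  have h0 := hsA x hx y hy
  rw [hc1, hd1, inner_smul_left, inner_smul_right] at h0
  have hd : d ≠ 0 := by rintro rfl; simp at hd1; exact hs0 hd1
  have hcc : c ≠ 0 := by rintro rfl; simp [sub_eq_zero] at hc1; exact hxy hc1
  have : (inner ℝ (N b) (N b) : ℝ) ≠ 0 := inner_self_ne_zero.2 (hN0 b hbU)
  simp_all

lemma exists_mem_normalCone [CompleteSpace E] {A : Set E} (hconv : Convex ℝ A)
    (hint : (interior A).Nonempty) {y : E} (hy : y ∈ frontier A) :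
    ∃ s ∈ normalCone A y, s ≠ 0 := by
  obtain ⟨f, hf⟩ := geometric_hahn_banach_open_point hconv.interior isOpen_interior hy.2
  have hle : ∀ a ∈ A, f a ≤ f y := by
    intro a ha
    have hcl' : a ∈ closure (interior A) := by
      rw [hconv.closure_interior_eq_closure_of_nonempty_interior hint]
      exact subset_closure ha
    exact closure_minimal (fun b hb => (hf b hb).le)
      (isClosed_le f.continuous continuous_const) hcl'
  refine ⟨(InnerProductSpace.toDual ℝ E).symm f, fun a ha => by simpa using hle a ha, ?_⟩
  obtain ⟨z, hz⟩ := hint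
  intro h0
  have : f = 0 := by simpa using h0
  simpa [this] using hf z hz

lemma eq_zero_of_mem_normalCone_neg {A : Set E} (hint : (interior A).Nonempty) {a s : E}
    (hs : s ∈ normalCone A a) (hs' : -s ∈ normalCone A a) : s = 0 := by
  obtain ⟨z, hz⟩ := hint
  by_contra h0
  have hzA := interior_subset hz
  refine (mem_frontier_of_mem_normalCone hzA h0 fun a' ha' => ?_).2 hz
  have h1 := hs a' ha'
  have h2 := hs' z hzA
  simp only [inner_neg_left, neg_le_neg_iff] at h2
  exact h1.trans h2

/-- Along the boundary of a convex body that is a hypersurface, the normal cones are half-lines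
spanned by a `C¹` vector field, the gradient of an outward increasing defining function. -/
lemma exists_normal_field [CompleteSpace E] {A : Set E} (hcl : IsClosed A) (hconv : Convex ℝ A)
    (hint : (interior A).Nonempty) (hM : IsC2Hypersurface (frontier A)) {a : E}
    (ha : a ∈ frontier A) : ∃ (U : Set E) (ρ : E → ℝ) (N : E → E), IsOpen U ∧ a ∈ U ∧
      ContDiffOn ℝ 1 N U ∧ ContDiffOn ℝ 1 ρ U ∧
      (∀ y ∈ U, HasStrictFDerivAt ρ (innerSL ℝ (N y)) y) ∧ (∀ y ∈ U, y ∈ frontier A ↔ ρ y = 0) ∧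
      (∀ y ∈ U, N y ≠ 0) ∧ ∀ y ∈ frontier A ∩ U, normalCone A y = halfLine (N y) := by
  obtain ⟨U, ρ, N, hU, haU, hN, hN0, hρc, hρ, hMU⟩ := hM.exists_gradient ha
  -- Orient the defining function so that its gradient at `a` is an outer normal.
  obtain ⟨U, ρ, N, hU, haU, hN, hN0, hρc, hρ, hMU, hout⟩ :
      ∃ (U : Set E) (ρ : E → ℝ) (N : E → E), IsOpen U ∧ a ∈ U ∧
      ContDiffOn ℝ 1 N U ∧ (∀ y ∈ U, N y ≠ 0) ∧ ContDiffOn ℝ 1 ρ U ∧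
      (∀ y ∈ U, HasStrictFDerivAt ρ (innerSL ℝ (N y)) y) ∧
      (∀ y ∈ U, y ∈ frontier A ↔ ρ y = 0) ∧ N a ∈ normalCone A a := by
    obtain ⟨s, hs, hs0⟩ := exists_mem_normalCone hconv hint ha
    obtain ⟨c, rfl⟩ := exists_smul_of_mem_normalCone (hU.mem_nhds haU) (hρ a haU) (hN0 a haU)
      ((hMU a haU).1 ha) hMU hcl.frontier_subset hs
    rcases lt_or_gt_of_ne (fun h : c = 0 => hs0 (by simp [h])) with hc | hc
    · refine ⟨U, fun y => -ρ y, fun y => -N y, hU, haU, hN.neg,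
        fun y hy => neg_ne_zero.2 (hN0 y hy), hρc.neg, fun y hy => ?_, fun y hy => by simpa using hMU y hy, fun y hy => ?_⟩
      · simpa using (hρ y hy).fun_neg
      · have := hs y hy
        simp only [inner_smul_left, inner_neg_left] at this ⊢
        simp at this
        nlinarith
    · refine ⟨U, ρ, N, hU, haU, hN, hN0, hρc, hρ, hMU, fun y hy => ?_⟩
      have := hs y hy
      simp only [inner_smul_left] at this
      simpa [hc] using this
  -- The gradient at `y` is outward as long as some `z ∈ A` lies strictly below its tangent plane.
  obtain ⟨z, hzA, hz⟩ : ∃ z ∈ A, (inner ℝ (N a) (z - a) : ℝ) < 0 := by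
    by_contra! h
    refine hN0 a haU (eq_zero_of_mem_normalCone_neg hint hout fun y hy => ?_)
    have := h y hy
    rw [inner_sub_right] at this
    simp only [inner_neg_left]
    linarith
  have hcont : ContinuousOn (fun y => (inner ℝ (N y) (z - y) : ℝ)) U :=
    hN.continuousOn.inner (continuousOn_const.sub continuousOn_id)
  have hV := hcont.isOpen_inter_preimage hU (isOpen_Iio (a := (0 : ℝ)))
  refine ⟨U ∩ (fun y => (inner ℝ (N y) (z - y) : ℝ)) ⁻¹' Iio 0, ρ, N, hV, ⟨haU, hz⟩,
    hN.mono inter_subset_left, hρc.mono inter_subset_left, fun y hy => hρ y hy.1,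
    fun y hy => hMU y hy.1, fun y hy => hN0 y hy.1, ?_⟩
  rintro y ⟨hyf, hyU, hyz⟩
  have key : ∀ s ∈ normalCone A y, ∃ c : ℝ, 0 ≤ c ∧ s = c • N y := by
    intro s hs
    obtain ⟨c, rfl⟩ := exists_smul_of_mem_normalCone (hU.mem_nhds hyU) (hρ y hyU) (hN0 y hyU)
      ((hMU y hyU).1 hyf) hMU hcl.frontier_subset hs
    refine ⟨c, ?_, rfl⟩
    have h1 := hs z hzA
    simp only [inner_smul_left] at h1
    simp only [mem_preimage, mem_Iio, inner_sub_right] at hyz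
    simp at h1
    nlinarith
  refine Subset.antisymm key ?_
  rintro _ ⟨r, hr, rfl⟩
  obtain ⟨s, hs, hs0⟩ := exists_mem_normalCone hconv hint hyf
  obtain ⟨c, hc, rfl⟩ := key s hs
  have hc' : 0 < c := lt_of_le_of_ne hc (fun h => hs0 (by simp [← h]))
  intro b hb
  have h1 := hs b hb
  simp only [inner_smul_left] at h1 ⊢
  simp [hc'] at h1
  exact mul_le_mul_of_nonneg_left h1 (by simpa using hr)

end Normal

/-! ### The Gauss map in the normalization of beliefs -/

section Gauss

variable {E : Type*} [NormedAddCommGroup E] [InnerProductSpace ℝ E]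

lemma gaussMap_eq_of_normalCone_eq {A : Set E} {a m : E} (hm : m ≠ 0)
    (h : normalCone A a = halfLine m) : gaussMap A a = ‖m‖⁻¹ • m := by
  have hm' : 0 < ‖m‖ := norm_pos_iff.2 hm
  have hex : ∃ s : E, ‖s‖ = 1 ∧ normalCone A a = halfLine s := by
    refine ⟨‖m‖⁻¹ • m, by simp [norm_smul, hm'.ne'], h.trans ?_⟩
    ext t
    constructor
    · rintro ⟨r, hr, rfl⟩
      exact ⟨r * ‖m‖, by positivity, by rw [smul_smul, mul_assoc, mul_inv_cancel₀ hm'.ne', mul_one]⟩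
    · rintro ⟨r, hr, rfl⟩
      exact ⟨r * ‖m‖⁻¹, by positivity, by rw [smul_smul]⟩
  rw [gaussMap, dif_pos hex]
  obtain ⟨h1, h2⟩ := hex.choose_spec
  generalize hex.choose = s at h1 h2 ⊢
  have hmem : s ∈ halfLine m := by
    rw [← h, h2]
    exact ⟨1, zero_le_one, by simp⟩
  obtain ⟨r, hr, hrm⟩ := hmem
  rw [hrm] at h1 ⊢
  rw [norm_smul, Real.norm_of_nonneg hr] at h1
  rw [eq_inv_of_mul_eq_one_left h1]

lemma gaussMap_mem_normalCone {A : Set E} {a m : E} (hm : m ≠ 0)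
    (h : normalCone A a = halfLine m) : gaussMap A a ∈ normalCone A a := by
  rw [gaussMap_eq_of_normalCone_eq hm h, h]
  exact ⟨‖m‖⁻¹, by positivity, rfl⟩

/-- Near `a`, the set `A` has the boundary `ρ = 0`, and `m` is a `C¹` vector field whose values span
the normal cones of `A` along this boundary. It is normalized by `⟪e, m⟫ = 1` rather than by
`‖m‖ = 1`: for `e` the vector of ones, `m` then takes beliefs as its values. The value `m a` is
prescribed to be `p`. -/
structure IsNormalField (A : Set E) (e p a : E) (U : Set E) (ρ : E → ℝ) (m : E → E) : Prop where
  isOpen : IsOpen U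
  mem : a ∈ U
  contDiffOn : ContDiffOn ℝ 1 m U
  contDiffOn_defining : ContDiffOn ℝ 1 ρ U
  hasStrictFDerivAt_defining : ∃ c : ℝ, c ≠ 0 ∧ HasStrictFDerivAt ρ (c • innerSL ℝ p) a
  mem_frontier_iff : ∀ y ∈ U, y ∈ frontier A ↔ ρ y = 0
  mem_frontier : a ∈ frontier A
  apply_self : m a = p
  inner_eq_one : ∀ y ∈ U, inner ℝ e (m y) = (1 : ℝ)
  normalCone_eq : ∀ y ∈ frontier A ∩ U, normalCone A y = halfLine (m y)

lemma exists_isNormalField [FiniteDimensional ℝ E] {A : Set E} (hc : IsCompact A)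
    (hconv : Convex ℝ A) (hnt : A.Nontrivial) (hM : IsC2Hypersurface (frontier A)) {e p a : E}
    (hep : inner ℝ e p = (1 : ℝ)) (haA : a ∈ A) (hp : p ∈ normalCone A a) :
    ∃ U ρ m, IsNormalField A e p a U ρ m := by
  have hp0 : p ≠ 0 := by rintro rfl; simp at hep
  have ha := mem_frontier_of_mem_normalCone haA hp0 hp
  obtain ⟨U, ρ, N, hU, haU, hN, hρc, hρ, hMU, hN0, hcone⟩ := exists_normal_field hc.isClosed hconv
    (interior_nonempty_of_isC2Hypersurface hc hconv hnt hM) hM ha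
  obtain ⟨r, hr, hrp⟩ : p ∈ halfLine (N a) := hcone a ⟨ha, haU⟩ ▸ hp
  have hr0 : r ≠ 0 := by rintro rfl; simp at hrp; exact hp0 hrp
  have hr1 : r * inner ℝ e (N a) = 1 := by rw [← inner_smul_right, ← hrp, hep]
  have hcont : ContDiffOn ℝ 1 (fun y => (inner ℝ e (N y) : ℝ)) U := contDiffOn_const.inner ℝ hN
  have hV := hcont.continuousOn.isOpen_inter_preimage hU (isOpen_Ioi (a := (0 : ℝ)))
  have hpos : 0 < (inner ℝ e (N a) : ℝ) := by
    by_contra! h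
    nlinarith
  refine ⟨U ∩ (fun y => (inner ℝ e (N y) : ℝ)) ⁻¹' Ioi 0, ρ,
    fun y => (inner ℝ e (N y) : ℝ)⁻¹ • N y, hV, ⟨haU, hpos⟩, ?_, hρc.mono inter_subset_left,
    ⟨r⁻¹, inv_ne_zero hr0, ?_⟩, fun y hy => hMU y hy.1, ha, ?_, fun y hy => ?_, fun y hy => ?_⟩
  · exact ((hcont.mono inter_subset_left).inv fun y hy => ne_of_gt hy.2).smul
      (hN.mono inter_subset_left)
  · convert hρ a haU using 1
    rw [hrp, map_smul, smul_smul, inv_mul_cancel₀ hr0, one_smul]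
  · rw [← eq_inv_of_mul_eq_one_left hr1, hrp]
  · rw [inner_smul_right]
    exact inv_mul_cancel₀ (ne_of_gt hy.2)
  · rw [hcone y ⟨hy.1, hy.2.1⟩]
    have h2 : 0 < (inner ℝ e (N y) : ℝ) := hy.2.2
    ext t
    constructor
    · rintro ⟨s, hs, rfl⟩
      exact ⟨s * inner ℝ e (N y), by positivity,
        by rw [smul_smul, mul_assoc, mul_inv_cancel₀ h2.ne', mul_one]⟩
    · rintro ⟨s, hs, rfl⟩
      exact ⟨s * (inner ℝ e (N y))⁻¹, by positivity, by rw [smul_smul]⟩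

namespace IsNormalField

variable {A : Set E} {e p a : E} {U : Set E} {ρ : E → ℝ} {m : E → E}

lemma ne_zero (h : IsNormalField A e p a U ρ m) {y : E} (hy : y ∈ U) : m y ≠ 0 := by
  intro h0
  have := h.inner_eq_one y hy
  simp [h0] at this

lemma hasFDerivAt (h : IsNormalField A e p a U ρ m) : HasFDerivAt m (fderiv ℝ m a) a :=
  ((h.contDiffOn.contDiffAt (h.isOpen.mem_nhds h.mem)).differentiableAt (by norm_num)).hasFDerivAt

/-- A point of the hyperplane `⟪e, ·⟫ = 1` that is normal to `A` at `y` is `m y`. -/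
lemma eq_of_mem_normalCone (h : IsNormalField A e p a U ρ m) {y q : E} (hy : y ∈ frontier A ∩ U)
    (hq : q ∈ normalCone A y) (heq : inner ℝ e q = (1 : ℝ)) : m y = q := by
  rw [h.normalCone_eq y hy] at hq
  obtain ⟨r, -, rfl⟩ := hq
  rw [inner_smul_right, h.inner_eq_one y hy.2, mul_one] at heq
  simp [heq]

lemma mem_tangent_iff [CompleteSpace E] (h : IsNormalField A e p a U ρ m) (t : E) :
    (t ∈ tangentSpaceAt (frontier A) a ↔ inner ℝ p t = (0 : ℝ)) ∧
      (t ∈ tangentConeAt ℝ (frontier A) a ↔ inner ℝ p t = (0 : ℝ)) := by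
  obtain ⟨c, hc, hρ⟩ := h.hasStrictFDerivAt_defining
  have hp0 : p ≠ 0 := h.apply_self ▸ h.ne_zero h.mem
  have hne : c • innerSL ℝ p ≠ 0 := smul_ne_zero hc fun h0 =>
    hp0 (inner_self_eq_zero.1 (DFunLike.congr_fun h0 p))
  have := tangent_of_zero_set (h.isOpen.mem_nhds h.mem) hρ hne
    ((h.mem_frontier_iff a h.mem).1 h.mem_frontier) h.mem_frontier_iff t
  simpa [hc] using this

lemma gaussMap_eventuallyEq (h : IsNormalField A e p a U ρ m) :
    ∀ᶠ y in 𝓝[frontier A] a, gaussMap A y = ‖m y‖⁻¹ • m y := by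
  filter_upwards [self_mem_nhdsWithin, mem_nhdsWithin_of_mem_nhds (h.isOpen.mem_nhds h.mem)]
    with y hy hyU
  exact gaussMap_eq_of_normalCone_eq (h.ne_zero hyU) (h.normalCone_eq y ⟨hy, hyU⟩)

lemma differentiableWithinAt_gaussMap (h : IsNormalField A e p a U ρ m) :
    DifferentiableWithinAt ℝ (gaussMap A) (frontier A) a := by
  have hm := h.hasFDerivAt.differentiableAt
  have : DifferentiableAt ℝ (fun y => ‖m y‖⁻¹ • m y) a :=
    ((hm.norm ℝ (h.ne_zero h.mem)).inv (norm_ne_zero_iff.2 (h.ne_zero h.mem))).smul hm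
  exact this.differentiableWithinAt.congr_of_eventuallyEq h.gaussMap_eventuallyEq
    (h.gaussMap_eventuallyEq.self_of_nhdsWithin h.mem_frontier)

/-- The Gauss map and the normalized field `m` are smooth functions of each other, so their
differentials have the same kernel on the tangent space. -/
lemma weingartenMap_eq_zero_iff [CompleteSpace E] (h : IsNormalField A e p a U ρ m)
    (t : tangentSpaceAt (frontier A) a) : weingartenMap A a t = 0 ↔ fderiv ℝ m a t = 0 := by
  have htc : (t : E) ∈ tangentConeAt ℝ (frontier A) a :=
    (h.mem_tangent_iff t).2.2 ((h.mem_tangent_iff t).1.1 t.2)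
  have hn := h.differentiableWithinAt_gaussMap.hasFDerivWithinAt
  have hm := h.hasFDerivAt
  have hma := h.ne_zero h.mem
  have hga := h.gaussMap_eventuallyEq.self_of_nhdsWithin h.mem_frontier
  change fderivWithin ℝ (gaussMap A) (frontier A) a t = 0 ↔ _
  constructor
  · intro h0
    have hea : (inner ℝ e (gaussMap A a) : ℝ) ≠ 0 := by
      rw [hga, inner_smul_right, h.inner_eq_one a h.mem, mul_one]
      exact inv_ne_zero (norm_ne_zero_iff.2 hma)
    have hpr : DifferentiableAt ℝ (fun x => (inner ℝ e x : ℝ)⁻¹ • x) (gaussMap A a) :=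
      (((differentiableAt_const e).inner ℝ differentiableAt_id).inv hea).smul differentiableAt_id
    have h1 := hpr.hasFDerivAt.comp_hasFDerivWithinAt a hn
    have h2 : HasFDerivWithinAt ((fun x => (inner ℝ e x : ℝ)⁻¹ • x) ∘ gaussMap A)
        (fderiv ℝ m a) (frontier A) a := by
      refine hm.hasFDerivWithinAt.congr_of_eventuallyEq ?_ ?_
      · filter_upwards [h.gaussMap_eventuallyEq,
          mem_nhdsWithin_of_mem_nhds (h.isOpen.mem_nhds h.mem)] with y hy hyU
        have hy0 : ‖m y‖ ≠ 0 := norm_ne_zero_iff.2 (h.ne_zero hyU)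
        simp [hy, inner_smul_right, h.inner_eq_one y hyU, smul_smul, hy0]
      · have hy0 : ‖m a‖ ≠ 0 := norm_ne_zero_iff.2 hma
        simp [hga, inner_smul_right, h.inner_eq_one a h.mem, smul_smul, hy0]
    rw [← h1.unique_on h2 htc]
    simp [h0]
  · intro h0
    have hpr : DifferentiableAt ℝ (fun x : E => ‖x‖⁻¹ • x) (m a) :=
      ((differentiableAt_id.norm ℝ hma).inv (norm_ne_zero_iff.2 hma)).smul differentiableAt_id
    have h1 := (hpr.hasFDerivAt.comp a hm).hasFDerivWithinAt (s := frontier A)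
    have h2 : HasFDerivWithinAt ((fun x : E => ‖x‖⁻¹ • x) ∘ m)
        (fderivWithin ℝ (gaussMap A) (frontier A) a) (frontier A) a :=
      hn.congr_of_eventuallyEq (h.gaussMap_eventuallyEq.mono fun y hy => hy.symm) hga.symm
    rw [h2.unique_on h1 htc]
    simp [h0]

/-- The Gauss map of a convex set is monotone, hence so is the Weingarten map. -/
lemma inner_weingartenMap_nonneg [CompleteSpace E] (hcl : IsClosed A)
    (h : IsNormalField A e p a U ρ m) (t : tangentSpaceAt (frontier A) a) :
    0 ≤ (inner ℝ (weingartenMap A a t) (t : E) : ℝ) := by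
  have htc : (t : E) ∈ tangentConeAt ℝ (frontier A) a :=
    (h.mem_tangent_iff t).2.2 ((h.mem_tangent_iff t).1.1 t.2)
  obtain ⟨α, l, hl, c, d, hd, hds, hcd⟩ := exists_fun_of_mem_tangentConeAt htc
  have hlim := (h.differentiableWithinAt_gaussMap.hasFDerivWithinAt.lim hd hds hcd).inner (𝕜 := ℝ)
    hcd
  refine ge_of_tendsto hlim ?_
  have hU : ∀ᶠ n in l, a + d n ∈ U := by
    have : Tendsto (fun n => a + d n) l (𝓝 a) := by simpa using hd.const_add a
    exact this.eventually_mem (h.isOpen.mem_nhds h.mem)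
  filter_upwards [hds, hU] with n hn hnU
  have h1 := gaussMap_mem_normalCone (h.ne_zero hnU) (h.normalCone_eq _ ⟨hn, hnU⟩) a
    (hcl.frontier_subset h.mem_frontier)
  have h2 := gaussMap_mem_normalCone (h.ne_zero h.mem) (h.normalCone_eq _ ⟨h.mem_frontier, h.mem⟩)
    (a + d n) (hcl.frontier_subset hn)
  simp only [inner_add_right] at h1 h2
  have h3 : 0 ≤ (inner ℝ (gaussMap A (a + d n) - gaussMap A a) (d n) : ℝ) := by
    rw [inner_sub_left]
    linarith
  rw [inner_smul_left, inner_smul_right]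
  simp only [conj_trivial]
  rw [← mul_assoc]
  exact mul_nonneg (mul_self_nonneg _) h3

/-- Positive curvature means that the normalized field `m` is an immersion of the boundary: an
eigenvalue of the Weingarten map is nonnegative by monotonicity, and it is zero only on the kernel
of the differential of `m`. -/
theorem hasPositiveCurvatureAt_iff [CompleteSpace E] (hcl : IsClosed A)
    (h : IsNormalField A e p a U ρ m) :
    HasPositiveCurvatureAt A a ↔ ∀ t, inner ℝ p t = (0 : ℝ) → fderiv ℝ m a t = 0 → t = 0 := by
  constructor
  · rintro ⟨-, -, hκ⟩ t hpt hmt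
    by_contra ht
    let t' : tangentSpaceAt (frontier A) a := ⟨t, (h.mem_tangent_iff t).1.2 hpt⟩
    refine lt_irrefl _ (hκ 0 ⟨t', fun h0 => ht (congrArg Subtype.val h0), ?_⟩)
    rw [(h.weingartenMap_eq_zero_iff t').2 hmt, zero_smul]
  · intro hinj
    refine ⟨⟨hcl.frontier_subset h.mem_frontier, m a, h.ne_zero h.mem,
      h.normalCone_eq a ⟨h.mem_frontier, h.mem⟩⟩, h.differentiableWithinAt_gaussMap, ?_⟩
    rintro κ ⟨t, ht, hκ⟩
    have ht0 : (t : E) ≠ 0 := fun h0 => ht (Subtype.ext h0)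
    have h1 := h.inner_weingartenMap_nonneg hcl t
    rw [hκ, inner_smul_left, conj_trivial] at h1
    have h2 : 0 < (inner ℝ (t : E) (t : E) : ℝ) := real_inner_self_pos.2 ht0
    refine lt_of_le_of_ne (nonneg_of_mul_nonneg_left h1 h2) fun h0 => ht0 ?_
    refine hinj t ((h.mem_tangent_iff t).1.1 t.2) ((h.weingartenMap_eq_zero_iff t).1 ?_)
    rw [hκ, ← h0, zero_smul]

end IsNormalField

end Gauss

/-! ### From positive curvature to a local diffeomorphism -/

section LocalDiffeo

variable {E : Type*} [NormedAddCommGroup E] [InnerProductSpace ℝ E]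

/-- The points of `A` at which the linear function `⟪q, ·⟫` is maximal on `A`. -/
def exposedFace (A : Set E) (q : E) : Set E :=
  {a ∈ A | q ∈ normalCone A a}

lemma convex_exposedFace {A : Set E} (hconv : Convex ℝ A) (q : E) : Convex ℝ (exposedFace A q) := by
  rintro x ⟨hxA, hx⟩ y ⟨hyA, hy⟩ s t hs ht hst
  refine ⟨hconv hxA hyA hs ht hst, fun b hb => ?_⟩
  have h1 := hx b hb
  have h2 := hy b hb
  rw [inner_add_right, inner_smul_right, inner_smul_right]
  calc (inner ℝ q b : ℝ) = s * inner ℝ q b + t * inner ℝ q b := by rw [← add_mul, hst, one_mul]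
    _ ≤ _ := by gcongr

/-- If `m` is an immersion of the boundary at `a`, then `Φ = (1 + ρ) m` is a local diffeomorphism of
the ambient space which maps precisely the boundary `ρ = 0` into the hyperplane `⟪e, ·⟫ = 1`. Its
inverse therefore selects an optimal point for each belief; the optimal point is unique because the
set of optimal points is convex and `Φ` is locally injective. -/
theorem IsNormalField.isLocalDiffeoAt [FiniteDimensional ℝ E] {A S W U : Set E} {e p a : E}
    {ρ : E → ℝ} {m : E → E} (h : IsNormalField A e p a U ρ m) (hcl : IsClosed A)
    (hconv : Convex ℝ A) (hW : IsOpen W) (hpW : p ∈ W)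
    (hS : ∀ q ∈ W, q ∈ S ↔ inner ℝ e q = (1 : ℝ))
    (hinj : ∀ t, inner ℝ p t = (0 : ℝ) → fderiv ℝ m a t = 0 → t = 0) :
    IsLocalDiffeoAt (exposedFace A) S (frontier A) p := by
  obtain ⟨c, hc, hρ⟩ := h.hasStrictFDerivAt_defining
  have hρa : ρ a = 0 := (h.mem_frontier_iff a h.mem).1 h.mem_frontier
  have hp0 : p ≠ 0 := h.apply_self ▸ h.ne_zero h.mem
  let Φ : E → E := fun y => (1 + ρ y) • m y
  have hinner : ∀ y ∈ U, inner ℝ e (Φ y) = 1 + ρ y := fun y hy => by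
    simp [Φ, inner_smul_right, h.inner_eq_one y hy]
  have hΦc : ContDiffAt ℝ 1 Φ a :=
    ((contDiffOn_const.add h.contDiffOn_defining).smul h.contDiffOn).contDiffAt
      (h.isOpen.mem_nhds h.mem)
  have hΦ' := (hρ.hasFDerivAt.const_add 1).fun_smul h.hasFDerivAt
  set Φ' : E →L[ℝ] E := _ with hΦ'def
  change HasFDerivAt Φ Φ' a at hΦ'
  have hΦ'v : ∀ t, Φ' t = fderiv ℝ m a t + (c * inner ℝ p t) • p := fun t => by
    simp [hΦ'def, hρa, h.apply_self]
  -- `⟪e, m⟫` is constant, so the differential of `m` takes its values in `⟪e, ·⟫ = 0`.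
  have hem : ∀ t, inner ℝ e (fderiv ℝ m a t) = (0 : ℝ) := fun t => by
    have h1 : HasFDerivAt (fun y => innerSL ℝ e (m y)) ((innerSL ℝ e).comp (fderiv ℝ m a)) a :=
      (innerSL ℝ e).hasFDerivAt.comp a h.hasFDerivAt
    have h2 : HasFDerivAt (fun y => innerSL ℝ e (m y)) (0 : E →L[ℝ] ℝ) a := by
      refine (hasFDerivAt_const (1 : ℝ) a).congr_of_eventuallyEq ?_
      filter_upwards [h.isOpen.mem_nhds h.mem] with y hy using h.inner_eq_one y hy
    simpa using DFunLike.congr_fun (h1.unique h2) t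
  have hep : inner ℝ e p = (1 : ℝ) := h.apply_self ▸ h.inner_eq_one a h.mem
  have hΦinj : Function.Injective (Φ' : E →ₗ[ℝ] E) := by
    refine (injective_iff_map_eq_zero _).2 fun t ht => ?_
    have ht' : fderiv ℝ m a t + (c * inner ℝ p t) • p = 0 := by rw [← hΦ'v]; exact ht
    have h1 := congrArg (fun x => (inner ℝ e x : ℝ)) ht'
    simp only [inner_add_right, inner_smul_right, hem, hep, inner_zero_right] at h1
    have h2 : (inner ℝ p t : ℝ) = 0 := by simpa [hc] using h1
    exact hinj t h2 (by simpa [h2] using ht')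
  let L : E ≃L[ℝ] E := (LinearEquiv.ofInjectiveEndo (Φ' : E →ₗ[ℝ] E) hΦinj).toContinuousLinearEquiv
  have hL : HasFDerivAt Φ (L : E →L[ℝ] E) a := by
    convert hΦ' using 1
    exact ContinuousLinearMap.ext fun t => rfl
  let H := hΦc.toOpenPartialHomeomorph Φ hL one_ne_zero
  have hHΦ : ∀ y, H y = Φ y := fun y => rfl
  have haH : a ∈ H.source := hΦc.mem_toOpenPartialHomeomorph_source hL one_ne_zero
  have hΦa : Φ a = p := by simp [Φ, hρa, h.apply_self]
  have hpH : p ∈ H.target := hΦa ▸ H.map_source haH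
  have hHp : H.symm p = a := by rw [← hΦa]; exact H.left_inv haH
  have hsymm : ContDiffAt ℝ 1 H.symm p := by
    have := hΦc.to_localInverse hL one_ne_zero
    rw [hΦa] at this
    exact this
  obtain ⟨P, hPsub, hPo, hpP⟩ :=
    eventually_nhds_iff.1 (hsymm.eventually (by simp))
  have hQo : IsOpen (H.target ∩ H.symm ⁻¹' U) := H.isOpen_inter_preimage_symm h.isOpen
  let U' : Set E := W ∩ P ∩ (H.target ∩ H.symm ⁻¹' U)
  have hU' : IsOpen U' := (hW.inter hPo).inter hQo
  let V : Set E := H.source ∩ (U ∩ m ⁻¹' U')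
  have hV : IsOpen V :=
    H.open_source.inter (h.contDiffOn.continuousOn.isOpen_inter_preimage h.isOpen hU')
  have key : ∀ q ∈ S ∩ U', H.symm q ∈ frontier A ∧ m (H.symm q) = q := by
    rintro q ⟨hqS, ⟨hqW, -⟩, hqT, hqU⟩
    have hΦq : Φ (H.symm q) = q := H.right_inv hqT
    have h1 := hinner _ hqU
    rw [hΦq, (hS q hqW).1 hqS] at h1
    have h2 : ρ (H.symm q) = 0 := by linarith
    refine ⟨(h.mem_frontier_iff _ hqU).2 h2, ?_⟩
    simpa [Φ, h2] using hΦq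
  have hΦm : ∀ y ∈ frontier A ∩ U, Φ y = m y := fun y hy => by
    simp [Φ, (h.mem_frontier_iff y hy.2).1 hy.1]
  refine ⟨U', V, H.symm, m, hU', ⟨⟨hpW, hpP⟩, hpH, by simpa [hHp] using h.mem⟩, hV,
    fun q hq => (hPsub q hq.1.2).contDiffWithinAt, h.contDiffOn.mono fun y hy => hy.2.1,
    ?_, ?_, ?_, ?_, ?_⟩
  · intro q hq
    obtain ⟨hfr, hmq⟩ := key q hq
    obtain ⟨hqS, ⟨hqW, -⟩, hqT, hqU⟩ := hq
    have hqe := (hS q hqW).1 hqS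
    have hq0 : q ≠ 0 := by rintro rfl; simp at hqe
    have hmem : H.symm q ∈ exposedFace A q := by
      refine ⟨hcl.frontier_subset hfr, ?_⟩
      rw [h.normalCone_eq _ ⟨hfr, hqU⟩, hmq]
      exact ⟨1, zero_le_one, by simp⟩
    refine Subset.antisymm (fun y hy => ?_) (singleton_subset_iff.2 hmem)
    -- A second optimal point would give optimal points arbitrarily close to `H.symm q`.
    have hlim : Tendsto (fun s : ℝ => (1 - s) • H.symm q + s • y) (𝓝[>] 0) (𝓝 (H.symm q)) := by
      have : Continuous (fun s : ℝ => (1 - s) • H.symm q + s • y) := by fun_prop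
      simpa using (this.tendsto 0).mono_left nhdsWithin_le_nhds
    have hxs : H.symm q ∈ H.source ∩ U := ⟨H.map_target hqT, hqU⟩
    obtain ⟨s, hsV, hs0, hs1⟩ := ((hlim.eventually_mem
      ((H.open_source.inter h.isOpen).mem_nhds hxs)).and
      (Ioo_mem_nhdsGT (zero_lt_one' ℝ))).exists
    have hz : (1 - s) • H.symm q + s • y ∈ exposedFace A q :=
      convex_exposedFace hconv q hmem hy (by linarith) hs0.le (by ring)
    have hzf := mem_frontier_of_mem_normalCone hz.1 hq0 hz.2
    have h1 : Φ ((1 - s) • H.symm q + s • y) = q :=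
      (hΦm _ ⟨hzf, hsV.2⟩).trans (h.eq_of_mem_normalCone ⟨hzf, hsV.2⟩ hz.2 hqe)
    have h2 : (1 - s) • H.symm q + s • y = H.symm q :=
      H.injOn hsV.1 hxs.1 (h1.trans (H.right_inv hqT).symm)
    have h3 : s • (y - H.symm q) = 0 := by
      rw [← sub_eq_zero] at h2
      rw [← h2]
      module
    simpa [hs0.ne', sub_eq_zero] using h3
  · intro q hq
    obtain ⟨hfr, hmq⟩ := key q hq
    exact ⟨hfr, H.map_target hq.2.2.1, hq.2.2.2, by simpa [hmq] using hq.2⟩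
  · rintro y ⟨-, -, hyU, hyU'⟩
    exact ⟨(hS _ hyU'.1.1).2 (h.inner_eq_one y hyU), hyU'⟩
  · exact fun q hq => (key q hq).2
  · rintro y ⟨hyf, hyH, hyU, -⟩
    rw [← hΦm y ⟨hyf, hyU⟩]
    exact H.left_inv hyH

end LocalDiffeo

/-! ### From a local diffeomorphism to the Hessian of the value function -/

section Hessian

/-- A function is differentiable at `u` if it has subgradients near `u` that are continuous
at `u`. -/
lemma hasFDerivAt_of_continuousAt_subgradient {X : Type*} [NormedAddCommGroup X] [NormedSpace ℝ X]
    {ψ : X → ℝ} {G : X → X →L[ℝ] ℝ} {u : X} (hG : ContinuousAt G u)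
    (h : ∀ᶠ w in 𝓝 u, G u (w - u) ≤ ψ w - ψ u ∧ ψ w - ψ u ≤ G w (w - u)) :
    HasFDerivAt ψ (G u) u := by
  rw [hasFDerivAt_iff_isLittleO, Asymptotics.isLittleO_iff]
  intro c hc
  filter_upwards [h, Metric.tendsto_nhds.1 hG c hc] with w hw hwc
  rw [dist_eq_norm] at hwc
  have h1 : (G w - G u) (w - u) ≤ c * ‖w - u‖ :=
    (le_abs_self _).trans (((G w - G u).le_opNorm _).trans (by gcongr))
  rw [sub_apply] at h1
  rw [Real.norm_of_nonneg (by linarith)]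
  linarith

variable {E : Type*} [NormedAddCommGroup E] [InnerProductSpace ℝ E]

/-- A vector `a`, as a linear function on a space `X` that `ι` maps into the ambient space. -/
noncomputable def pullbackInner [FiniteDimensional ℝ E] {X : Type*} [NormedAddCommGroup X]
    [NormedSpace ℝ X] (ι : X →L[ℝ] E) : E →L[ℝ] X →L[ℝ] ℝ :=
  LinearMap.toContinuousLinearMap
    { toFun := fun a => (innerSL ℝ a).comp ι
      map_add' := fun a b => by ext; simp
      map_smul' := fun c a => by ext; simp }

@[simp]
lemma pullbackInner_apply [FiniteDimensional ℝ E] {X : Type*} [NormedAddCommGroup X]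
    [NormedSpace ℝ X] (ι : X →L[ℝ] E) (a : E) (u : X) :
    pullbackInner ι a u = inner ℝ a (ι u) := rfl

lemma eq_zero_of_inner_eq_zero {e p z : E} (hep : inner ℝ e p = (1 : ℝ))
    (hz : ∀ w, inner ℝ e w = (0 : ℝ) → inner ℝ z w = (0 : ℝ)) (hpz : inner ℝ p z = (0 : ℝ)) :
    z = 0 := by
  have h1 := hz (z - (inner ℝ e z : ℝ) • p) (by simp [inner_sub_right, inner_smul_right, hep])
  rw [inner_sub_right, inner_smul_right, real_inner_comm p z, hpz] at h1
  simpa using h1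

/-- A positive semidefinite symmetric form is positive on the vectors outside its kernel. -/
lemma pos_of_symm_of_nonneg {X : Type*} [NormedAddCommGroup X] [NormedSpace ℝ X]
    (B : X →L[ℝ] X →L[ℝ] ℝ) (hsymm : ∀ u w, B u w = B w u) (hnn : ∀ u, 0 ≤ B u u) {u : X}
    (hu : B u ≠ 0) : 0 < B u u := by
  refine lt_of_le_of_ne (hnn u) fun h0 => hu ?_
  ext w
  have h := fun s : ℝ => hnn (u + s • w)
  simp only [map_add, map_smul, add_apply, smul_apply,
    smul_eq_mul, ← h0, hsymm w u] at h
  have hc := hnn w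
  -- A small enough positive multiple of `-B u w` violates nonnegativity if `B u w ≠ 0`.
  have h1 := h (-(B u w) / (B w w + 1))
  have h2 : -(B u w) / (B w w + 1) * (B u w) + (-(B u w) / (B w w + 1) * (B u w) +
      -(B u w) / (B w w + 1) * (-(B u w) / (B w w + 1) * (B w w)))
      = -((B u w) ^ 2 * ((B w w + 2) / (B w w + 1) ^ 2)) := by
    field_simp
    ring
  have h3 : 0 ≤ -((B u w) ^ 2 * ((B w w + 2) / (B w w + 1) ^ 2)) := by
    rw [← h2]; linarith
  have h4 : 0 < (B w w + 2) / (B w w + 1) ^ 2 := by positivity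
  have h5 : (B u w) ^ 2 ≤ 0 := by
    by_contra! h
    nlinarith [mul_pos h h4]
  simpa using le_antisymm h5 (sq_nonneg _)

/-- The differential of a monotone map into the dual space is positive semidefinite. -/
lemma apply_self_nonneg_of_monotone {X : Type*} [NormedAddCommGroup X] [NormedSpace ℝ X]
    {G : X → X →L[ℝ] ℝ} {B : X →L[ℝ] X →L[ℝ] ℝ} (hB : HasFDerivAt G B 0)
    (hG : ∀ᶠ u in 𝓝 0, G 0 u ≤ G u u) (w : X) : 0 ≤ B w w := by
  have hline : HasDerivAt (fun s : ℝ => s • w) w 0 := by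
    simpa using (hasDerivAt_id (0 : ℝ)).smul_const w
  have h2 : HasFDerivAt G B ((0 : ℝ) • w) := by rwa [zero_smul]
  have h1 : HasDerivAt (fun s : ℝ => G (s • w)) (B w) 0 := h2.comp_hasDerivAt (0 : ℝ) hline
  have h3 : HasDerivAt (fun s : ℝ => G (s • w) w) (B w w) 0 := by
    simpa using h1.clm_apply (hasDerivAt_const (0 : ℝ) w)
  refine ge_of_tendsto (hasDerivAt_iff_tendsto_slope.1 h3) ?_
  have hc : Tendsto (fun s : ℝ => s • w) (𝓝[≠] 0) (𝓝 0) := by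
    simpa using hline.continuousAt.tendsto.mono_left nhdsWithin_le_nhds
  filter_upwards [hc.eventually hG, self_mem_nhdsWithin] with s hs hs0
  simp only [map_smul, smul_eq_mul] at hs
  simp only [slope, sub_zero, vsub_eq_sub, smul_eq_mul, zero_smul]
  have h4 : s⁻¹ * (G (s • w) w - G 0 w) = (s⁻¹) ^ 2 * (s * G (s • w) w - s * G 0 w) := by
    have : s ≠ 0 := hs0
    field_simp
  rw [h4]
  exact mul_nonneg (sq_nonneg _) (by linarith)

/-- The value function has the optimal point `f` as its gradient. Its Hessian is the differential of
`f`, which is injective because `f` has a differentiable inverse, and its values are orthogonal to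
`p` because `⟪p, f⟫` is maximal at `p`. -/
theorem IsLocalDiffeoAt.hessian_posDef [FiniteDimensional ℝ E] {A S T W : Set E} {e p : E}
    {X : Type*} [NormedAddCommGroup X] [NormedSpace ℝ X] {ι : X →L[ℝ] E} {v : E → ℝ}
    (hdiff : IsLocalDiffeoAt (exposedFace A) S T p)
    (hep : inner ℝ e p = (1 : ℝ)) (hι : Function.Injective ι)
    (hι0 : ∀ u, inner ℝ e (ι u) = (0 : ℝ)) (hιe : ∀ w, inner ℝ e w = (0 : ℝ) → ∃ u, ι u = w)
    (hW : IsOpen W) (hpW : p ∈ W) (hS : ∀ q ∈ W, q ∈ S ↔ inner ℝ e q = (1 : ℝ))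
    (hv : ∀ q, ∀ a ∈ exposedFace A q, v q = inner ℝ q a) :
    (∀ᶠ u in 𝓝 0, DifferentiableAt ℝ (fun u : X => v (p + ι u)) u) ∧
      DifferentiableAt ℝ (fderiv ℝ (fun u : X => v (p + ι u))) 0 ∧
      ∀ u : X, u ≠ 0 → 0 < fderiv ℝ (fderiv ℝ (fun u : X => v (p + ι u))) 0 u u := by
  obtain ⟨U, V, f, g, hU, hpU, hV, hf, hg, hF, hfm, hgm, hinv⟩ := hdiff
  let ψ : X → ℝ := fun u => v (p + ι u)
  let τ : X → E := fun u => p + ι u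
  have hτ : ∀ u, HasFDerivAt τ ι u := fun u => (ι.hasFDerivAt).const_add p
  let O : Set X := τ ⁻¹' (U ∩ W)
  have hO : IsOpen O := (hU.inter hW).preimage (continuous_iff_continuousAt.2 fun u =>
    (hτ u).continuousAt)
  have h0O : (0 : X) ∈ O := by simpa [O, τ] using ⟨hpU, hpW⟩
  have hτ0 : τ 0 = p := by simp [τ]
  have hOS : ∀ u ∈ O, τ u ∈ S ∩ U := fun u hu =>
    ⟨(hS _ hu.2).2 (by simp [τ, inner_add_right, hep, hι0 u]), hu.1⟩
  have hface : ∀ u ∈ O, f (τ u) ∈ exposedFace A (τ u) := fun u hu => by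
    rw [hF _ (hOS u hu)]; rfl
  let G : X → X →L[ℝ] ℝ := fun u => pullbackInner ι (f (τ u))
  have hG : ∀ u ∈ O, HasFDerivAt G
      ((pullbackInner ι).comp ((fderiv ℝ f (τ u)).comp ι)) u := fun u hu => by
    have h1 : HasFDerivAt (f ∘ τ) ((fderiv ℝ f (τ u)).comp ι) u :=
      ((hf.contDiffAt (hU.mem_nhds hu.1)).differentiableAt (by norm_num)).hasFDerivAt.comp u (hτ u)
    exact ((pullbackInner ι).hasFDerivAt (x := f (τ u))).comp u h1
  have hsub : ∀ u ∈ O, ∀ w ∈ O, G u (w - u) ≤ ψ w - ψ u := fun u hu w hw => by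
    have h1 := (hface w hw).2 _ (hface u hu).1
    have h2 : ψ w = _ := hv _ _ (hface w hw)
    have h3 : ψ u = _ := hv _ _ (hface u hu)
    rw [h2, h3]
    refine le_trans (le_of_eq ?_) (sub_le_sub_right h1 _)
    simp only [G, pullbackInner_apply, τ, map_sub, inner_add_left,
      real_inner_comm]
    ring
  have hsub' : ∀ u ∈ O, ∀ w ∈ O, ψ w - ψ u ≤ G w (w - u) := fun u hu w hw => by
    have := hsub w hw u hu
    rw [← neg_sub w u, map_neg] at this
    linarith
  have hψ : ∀ u ∈ O, HasFDerivAt ψ (G u) u := fun u hu => by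
    refine hasFDerivAt_of_continuousAt_subgradient (hG u hu).continuousAt ?_
    filter_upwards [hO.mem_nhds hu] with w hw using ⟨hsub u hu w hw, hsub' u hu w hw⟩
  have hev : ∀ᶠ u in 𝓝 (0 : X), HasFDerivAt ψ (G u) u := by
    filter_upwards [hO.mem_nhds h0O] with u hu using hψ u hu
  have hB := hG 0 h0O
  rw [hτ0] at hB
  have hψ'' : HasFDerivAt (fderiv ℝ ψ) _ 0 :=
    hB.congr_of_eventuallyEq (hev.mono fun u hu => hu.fderiv)
  refine ⟨hev.mono fun u hu => hu.differentiableAt, hψ''.differentiableAt, fun u hu => ?_⟩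
  change 0 < fderiv ℝ (fderiv ℝ ψ) 0 u u
  rw [hψ''.fderiv]
  refine pos_of_symm_of_nonneg _ (second_derivative_symmetric_of_eventually hev hB) ?_ ?_
  · refine apply_self_nonneg_of_monotone hB ?_
    filter_upwards [hO.mem_nhds h0O] with w hw
    have h3 := (hsub 0 h0O w hw).trans (hsub' 0 h0O w hw)
    rw [sub_zero] at h3
    exact h3
  · intro hB0
    refine hu (hι ?_)
    rw [map_zero]
    have hfp : HasFDerivAt f (fderiv ℝ f p) (τ 0) := by
      rw [hτ0]
      exact ((hf.contDiffAt (hU.mem_nhds hpU)).differentiableAt (by norm_num)).hasFDerivAt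
    have hfτ := hfp.comp (0 : X) (hτ 0)
    have hpf : inner ℝ p (fderiv ℝ f p (ι u)) = (0 : ℝ) := by
      have hmax : IsLocalMax (fun w : X => innerSL ℝ p (f (τ w))) 0 := by
        filter_upwards [hO.mem_nhds h0O] with w hw
        have := (hface 0 h0O).2 _ (hface w hw).1
        rw [hτ0] at this ⊢
        exact this
      have := hmax.hasFDerivAt_eq_zero ((innerSL ℝ p).hasFDerivAt.comp (0 : X) hfτ)
      exact DFunLike.congr_fun this u
    have hz : fderiv ℝ f p (ι u) = 0 := by
      refine eq_zero_of_inner_eq_zero hep (fun w hw => ?_) hpf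
      obtain ⟨u', rfl⟩ := hιe w hw
      exact DFunLike.congr_fun hB0 u'
    have hgd : HasFDerivAt g (fderiv ℝ g (f p)) (f (τ 0)) := by
      have hfV := (hfm (hOS 0 h0O)).2
      rw [hτ0] at hfV ⊢
      exact ((hg.contDiffAt (hV.mem_nhds hfV)).differentiableAt (by norm_num)).hasFDerivAt
    have h1 := hgd.comp (0 : X) hfτ
    have h2 : HasFDerivAt (g ∘ f ∘ τ) ι 0 := by
      refine (hτ 0).congr_of_eventuallyEq ?_
      filter_upwards [hO.mem_nhds h0O] with w hw using hinv.1 (hOS w hw)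
    have h3 := DFunLike.congr_fun (h1.unique h2) u
    simp [hz] at h3
    exact h3.symm

end Hessian

/-! ### From the Hessian of the value function to positive curvature -/

section Curvature

variable {E : Type*} [NormedAddCommGroup E] [InnerProductSpace ℝ E]

/-- If the value function is differentiable in the hyperplane `⟪e, ·⟫ = 1`, optimal points are
unique: their component in the hyperplane is the gradient, the other component is determined by
the value. If the gradient is differentiable, so is the selection `f` of optimal points. -/
lemma exists_differentiableAt_optimal [FiniteDimensional ℝ E] {A : Set E} {e p : E}
    {H : Submodule ℝ E} {v : E → ℝ} (hep : inner ℝ e p = (1 : ℝ))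
    (hH : ∀ u, u ∈ H ↔ inner ℝ e u = (0 : ℝ))
    (hne : ∀ q, (exposedFace A q).Nonempty)
    (hv : ∀ q, ∀ a ∈ exposedFace A q, v q = inner ℝ q a)
    (hd1 : ∀ᶠ u in 𝓝 0, DifferentiableAt ℝ (fun u : H => v (p + u)) u)
    (hd2 : DifferentiableAt ℝ (fderiv ℝ (fun u : H => v (p + u))) 0) :
    ∃ f : H → E, DifferentiableAt ℝ f 0 ∧ ∀ᶠ u : H in 𝓝 0, exposedFace A (p + u) = {f u} := by
  let ψ : H → ℝ := fun u => v (p + u)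
  let gr : H → H := fun u => (InnerProductSpace.toDual ℝ H).symm (fderiv ℝ ψ u)
  have hgr : ∀ u w : H, inner ℝ (gr u : E) (w : E) = fderiv ℝ ψ u w := fun u w =>
    InnerProductSpace.toDual_symm_apply (𝕜 := ℝ) (E := H) (x := w) (y := fderiv ℝ ψ u)
  have hgrd : DifferentiableAt ℝ (fun u => (gr u : E)) 0 :=
    H.subtypeL.differentiableAt.comp (0 : H)
      ((InnerProductSpace.toDual ℝ H).symm.differentiable.differentiableAt.comp (0 : H) hd2)
  have hτ : DifferentiableAt ℝ (fun u : H => p + (u : E)) 0 :=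
    H.subtypeL.differentiableAt.const_add p
  refine ⟨fun u => (gr u : E) + (ψ u - inner ℝ (p + (u : E)) (gr u : E)) • e, ?_, ?_⟩
  · exact hgrd.add ((hd1.self_of_nhds.sub (hτ.inner ℝ hgrd)).smul_const e)
  · filter_upwards [hd1] with u hu
    have hsub : ∀ a ∈ exposedFace A (p + u),
        a = (gr u : E) + (ψ u - inner ℝ (p + (u : E)) (gr u : E)) • e := by
      intro a ha
      have hq : inner ℝ e (p + (u : E)) = (1 : ℝ) := by
        simp [inner_add_right, hep, (hH u).1 u.2]
      have hmin : IsLocalMin (fun w : H => ψ w - pullbackInner H.subtypeL a w) u := by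
        refine Eventually.of_forall fun w => ?_
        obtain ⟨b, hb⟩ := hne (p + w)
        have h1 := hb.2 a ha.1
        have h2 : ψ w = _ := hv _ _ hb
        have h3 : ψ u = _ := hv _ _ ha
        simp only [pullbackInner_apply, h2, h3, Submodule.subtypeL_apply]
        rw [inner_add_left p (w : E) a] at h1
        rw [inner_add_left p (u : E) a, real_inner_comm (u : E) a, real_inner_comm (w : E) a]
        linarith
      have hder := hmin.hasFDerivAt_eq_zero
        (hu.hasFDerivAt.sub (pullbackInner H.subtypeL a).hasFDerivAt)
      refine sub_eq_zero.1 (eq_zero_of_inner_eq_zero hq (fun w hw => ?_) ?_)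
      · have h1 := DFunLike.congr_fun hder (⟨w, (hH w).2 hw⟩ : H)
        have h2 := hgr u ⟨w, (hH w).2 hw⟩
        simp only [sub_apply, pullbackInner_apply,
          zero_apply] at h1
        change inner ℝ (gr u : E) w = _ at h2
        rw [inner_sub_left, inner_add_left, inner_smul_left, hw, h2]
        change fderiv ℝ ψ u _ - inner ℝ a w = 0 at h1
        rw [mul_zero, add_zero]
        linarith
      · rw [inner_sub_right, inner_add_right, inner_smul_right, real_inner_comm e, hq,
          ← hv _ _ ha]
        change ψ u - _ = 0
        ring
    obtain ⟨b, hb⟩ := hne (p + u)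
    exact Subset.antisymm hsub (singleton_subset_iff.2 (hsub b hb ▸ hb))

/-- On the boundary, the normalized field `m` is a left inverse of a differentiable selection of
optimal points. The differential of this selection maps the directions `⟪e, ·⟫ = 0` injectively,
hence by dimension surjectively, to the tangent space, and so the differential of `m` is injective
there. -/
lemma IsNormalField.injective_of_selection [FiniteDimensional ℝ E] {A U : Set E} {e p : E}
    {ρ : E → ℝ} {m : E → E} {H : Submodule ℝ E} {f : H → E}
    (h : IsNormalField A e p (f 0) U ρ m) (hep : inner ℝ e p = (1 : ℝ))
    (hH : ∀ u, u ∈ H ↔ inner ℝ e u = (0 : ℝ)) (hf : DifferentiableAt ℝ f 0)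
    (hface : ∀ᶠ u : H in 𝓝 0, f u ∈ exposedFace A (p + u)) {t : E} (hpt : inner ℝ p t = (0 : ℝ))
    (hmt : fderiv ℝ m (f 0) t = 0) : t = 0 := by
  have hp0 : p ≠ 0 := by rintro rfl; simp at hep
  have hmf : ∀ u, fderiv ℝ m (f 0) (fderiv ℝ f 0 u) = u := by
    have h1 := h.hasFDerivAt.comp (0 : H) hf.hasFDerivAt
    have h2 : HasFDerivAt (m ∘ f) H.subtypeL 0 := by
      refine ((H.subtypeL.hasFDerivAt).const_add p).congr_of_eventuallyEq ?_
      filter_upwards [hface, hf.continuousAt.eventually_mem (h.isOpen.mem_nhds h.mem)] with u hu huU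
      have hq : inner ℝ e (p + (u : E)) = (1 : ℝ) := by
        simp [inner_add_right, hep, (hH u).1 u.2]
      have hq0 : p + (u : E) ≠ 0 := by intro h0; simp [h0] at hq
      exact h.eq_of_mem_normalCone ⟨mem_frontier_of_mem_normalCone hu.1 hq0 hu.2, huU⟩ hu.2 hq
    exact fun u => DFunLike.congr_fun (h1.unique h2) u
  have hpf : ∀ u, inner ℝ p (fderiv ℝ f 0 u) = (0 : ℝ) := by
    have hmax : IsLocalMax (fun w : H => innerSL ℝ p (f w)) 0 := by
      have h0 := hface.self_of_nhds
      rw [ZeroMemClass.coe_zero, add_zero] at h0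
      filter_upwards [hface] with w hw using h0.2 _ hw.1
    have := hmax.hasFDerivAt_eq_zero ((innerSL ℝ p).hasFDerivAt.comp (0 : H) hf.hasFDerivAt)
    exact fun u => DFunLike.congr_fun this u
  -- Extend the differential of `f` to an endomorphism of the whole space that fixes `p`.
  let pr : E →ₗ[ℝ] H :=
    { toFun := fun x => ⟨x - (inner ℝ e x : ℝ) • p, (hH _).2 (by
        simp [inner_sub_right, inner_smul_right, hep])⟩
      map_add' := fun x y => Subtype.ext (by simp [inner_add_right]; module)
      map_smul' := fun c x => Subtype.ext (by simp [inner_smul_right]; module) }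
  let T : E →ₗ[ℝ] E :=
    { toFun := fun x => fderiv ℝ f 0 (pr x) + (inner ℝ e x : ℝ) • p
      map_add' := fun x y => by simp [inner_add_right]; module
      map_smul' := fun c x => by simp [inner_smul_right]; module }
  have hTe : ∀ x, inner ℝ p (T x) = (0 : ℝ) → inner ℝ e x = (0 : ℝ) := fun x hx => by
    change inner ℝ p (fderiv ℝ f 0 (pr x) + (inner ℝ e x : ℝ) • p) = (0 : ℝ) at hx
    rw [inner_add_right, hpf, inner_smul_right, zero_add] at hx
    exact (mul_eq_zero.1 hx).resolve_right (inner_self_ne_zero.2 hp0)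
  have hT : ∀ x, inner ℝ p (T x) = (0 : ℝ) → fderiv ℝ m (f 0) (T x) = x := fun x hx => by
    have hx0 := hTe x hx
    change fderiv ℝ m (f 0) (fderiv ℝ f 0 (pr x) + (inner ℝ e x : ℝ) • p) = x
    rw [hx0, zero_smul, add_zero, hmf]
    simp [pr, hx0]
  have hinj : Function.Injective T := (injective_iff_map_eq_zero T).2 fun x hx => by
    have := hT x (by simp [hx])
    rw [hx, map_zero] at this
    exact this.symm
  obtain ⟨x, rfl⟩ := (LinearMap.injective_iff_surjective.1 hinj) t
  have := hT x hpt
  rw [hmt] at this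
  simp [← this]

end Curvature

/-! ### Beliefs and action sets -/

section Beliefs

variable {K : Type*} [Fintype K]

lemma inner_ones (x : EuclideanSpace ℝ K) :
    inner ℝ (WithLp.toLp 2 (fun _ => 1) : EuclideanSpace ℝ K) x = ∑ k, x k := by
  simp [PiLp.inner_apply]

lemma optimalActions_eq_exposedFace (A : Set (EuclideanSpace ℝ K)) :
    optimalActions A = exposedFace A := rfl

lemma isCompact_actionSet {D : Type*} [TopologicalSpace D] [CompactSpace D] {g : D → K → ℝ}
    (hg : Continuous g) : IsCompact (actionSet g) := by
  refine Metric.isCompact_of_isClosed_isBounded isClosed_closure ?_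
  have : IsCompact (range fun d => (WithLp.toLp 2 (g d) : EuclideanSpace ℝ K)) :=
    isCompact_range ((PiLp.continuous_toLp 2 _).comp hg)
  exact (isBounded_convexHull.2 this.isBounded).closure

lemma valueFunction_eq {A : Set (EuclideanSpace ℝ K)} {q a : EuclideanSpace ℝ K}
    (ha : a ∈ exposedFace A q) : valueFunction A q = inner ℝ q a :=
  IsGreatest.csSup_eq ⟨mem_image_of_mem _ ha.1, by rintro _ ⟨b, hb, rfl⟩; exact ha.2 b hb⟩

lemma exposedFace_nonempty {E : Type*} [NormedAddCommGroup E] [InnerProductSpace ℝ E] {A : Set E}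
    (hc : IsCompact A) (hA : A.Nonempty) (q : E) : (exposedFace A q).Nonempty := by
  obtain ⟨a, ha, hmax⟩ := hc.exists_isMaxOn hA (innerSL ℝ q).continuous.continuousOn
  exact ⟨a, ha, fun b hb => hmax hb⟩

end Beliefs

end FlexibleAgent

theorem mainTheorem5 {K D : Type*} [Fintype K] [TopologicalSpace D] [CompactSpace D]
    (g : D → K → ℝ) (hg : Continuous g)
    (hA : (FlexibleAgent.actionSet g).Nontrivial)
    (hC2 : FlexibleAgent.IsC2Hypersurface (frontier (FlexibleAgent.actionSet g)))
    (p : EuclideanSpace ℝ K) (hp : p ∈ FlexibleAgent.beliefs K) (hfull : ∀ k, 0 < p k) :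
    List.TFAE [
      FlexibleAgent.IsLocalDiffeoAt (FlexibleAgent.optimalActions (FlexibleAgent.actionSet g))
        (FlexibleAgent.beliefs K) (frontier (FlexibleAgent.actionSet g)) p,
      ∃ a, FlexibleAgent.optimalActions (FlexibleAgent.actionSet g) p = {a} ∧
        FlexibleAgent.HasPositiveCurvatureAt (FlexibleAgent.actionSet g) a,
      FlexibleAgent.TwiceDiffWithPosDefHessianAt
        (FlexibleAgent.valueFunction (FlexibleAgent.actionSet g)) p] := by
  open FlexibleAgent in
  set A := actionSet g with hAdef
  have hc : IsCompact A := isCompact_actionSet hg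
  have hconv : Convex ℝ A := (convex_convexHull ℝ _).closure
  let e : EuclideanSpace ℝ K := WithLp.toLp 2 (fun _ => 1)
  let W : Set (EuclideanSpace ℝ K) := {q | ∀ k, 0 < q k}
  have hep : inner ℝ e p = (1 : ℝ) := (inner_ones p).trans hp.2
  have hH : ∀ u, u ∈ beliefDirections K ↔ inner ℝ e u = (0 : ℝ) := fun u => by
    rw [inner_ones]; rfl
  have hW : IsOpen W := by
    simp only [W, Set.ofPred_forall]
    exact isOpen_iInter_of_finite fun k => isOpen_lt continuous_const (by fun_prop)
  have hS : ∀ q ∈ W, q ∈ beliefs K ↔ inner ℝ e q = (1 : ℝ) := fun q hq => by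
    rw [inner_ones]
    exact ⟨fun h => h.2, fun h => ⟨fun k => (hq k).le, h⟩⟩
  have hv : ∀ q, ∀ a ∈ exposedFace A q, valueFunction A q = inner ℝ q a :=
    fun q a ha => valueFunction_eq ha
  rw [optimalActions_eq_exposedFace]
  tfae_have 2 → 1 := by
    rintro ⟨a, ha, hcurv⟩
    have hap : a ∈ exposedFace A p := ha ▸ Set.mem_singleton a
    obtain ⟨U, ρ, m, h⟩ := exists_isNormalField hc hconv hA hC2 hep hap.1 hap.2
    exact h.isLocalDiffeoAt hc.isClosed hconv hW hfull hS
      ((h.hasPositiveCurvatureAt_iff hc.isClosed).1 hcurv)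
  tfae_have 1 → 3 := fun h => h.hessian_posDef (ι := (beliefDirections K).subtypeL)
    hep Subtype.val_injective (fun u => (hH u).1 u.2) (fun w hw => ⟨⟨w, (hH w).2 hw⟩, rfl⟩)
    hW hfull hS hv
  tfae_have 3 → 2 := by
    rintro ⟨hd1, hd2, -⟩
    obtain ⟨f, hf, hface⟩ := exists_differentiableAt_optimal hep hH
      (exposedFace_nonempty hc hA.nonempty) hv hd1 hd2
    have hmem : ∀ᶠ u : beliefDirections K in nhds 0, f u ∈ exposedFace A (p + u) :=
      hface.mono fun u hu => hu ▸ Set.mem_singleton _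
    have h0 : exposedFace A p = {f 0} := by simpa using hface.self_of_nhds
    have hfp : f 0 ∈ exposedFace A p := h0 ▸ Set.mem_singleton _
    obtain ⟨U, ρ, m, h⟩ := exists_isNormalField hc hconv hA hC2 hep hfp.1 hfp.2
    exact ⟨f 0, h0, (h.hasPositiveCurvatureAt_iff hc.isClosed).2 fun t =>
      h.injective_of_selection hep hH hf hmem⟩
  tfae_finish
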